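/- Let $G$ be a finite group and $H\le G$ a subgroup. The interval $[H,G]$ is the lattice of subgroups $K$ with $H\le K\le G$; it is Boolean of rank $n$ if it is isomorphic to the lattice of subsets of an $n$-element set. The coset poset $C(H,G)$ is the set of all right cosets $Kg$ with $g\in G$ and $H\le K<G$, ordered by inclusion, and $\hat C(H,G)=C(H,G)\sqcup\{\emptyset,G\}$, also ordered by inclusion; its proper part is $C(H,G)$. The dual Euler totient is $\hat\varphi(H,G)=\sum_{K\in[H,G]}\mu(H,K)\,|G:K|$, where $\mu$ is the Möbius function of $[H,G]$. For a finite poset $P$, $\Delta(P)$ is its order complex (the simplicial complex whose faces are the chains of $P$, including the empty chain), and $\tilde\beta_i(\Delta(P))$ is the dimension of its $i$-th reduced homology space over $\mathbb C$. A poset is connected if it is nonempty and any two of its elements are joined by a finite sequence of elements in which consecutive ones are comparable. A finite poset is graded if it has a minimum and a maximum and all its maximal chains have the same length; a graded poset is Cohen–Macaulay (over $\mathbb C$) if for every open interval $(x,y)$ in it, $\tilde\beta_i(\Delta((x,y)))=0$ for all $i<\dim\Delta((x,y))$. (1) If $[H,G]$ is Boolean of rank $n\ge 2$, then the proper part $C(H,G)$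 of $\hat C(H,G)$ is connected. (2) If $[H,G]$ is Boolean of rank $2$, then $\hat\varphi(H,G)\ge 1$; the poset $\hat C(H,G)$ is graded and Cohen–Macaulay; and $\Delta(C(H,G))$ has dimension $1$ and $\tilde\beta_1(\Delta(C(H,G)))\ne 0$. -/

import Mathlib

/-- The interval `[H, G]` of the subgroup lattice of `G` is Boolean of rank `n`: it is isomorphic
to the lattice of all subsets of an `n`-element set. -/
def IsBooleanInterval {G : Type*} [Group G] (H : Subgroup G) (n : ℕ) : Prop :=
  Nonempty (Set.Icc H (⊤ : Subgroup G) ≃o Finset (Fin n))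

/-- `S` is a right coset `K g` with `H ≤ K < G`. -/
def IsProperCosetOver {G : Type*} [Group G] (H : Subgroup G) (S : Set G) : Prop :=
  ∃ K : Subgroup G, H ≤ K ∧ K < ⊤ ∧ ∃ g : G, S = (fun k => k * g) '' (K : Set G)

/-- The coset poset `C(H, G)`, ordered by inclusion. -/
abbrev CosetPoset {G : Type*} [Group G] (H : Subgroup G) : Type _ :=
  {S : Set G // IsProperCosetOver H S}

/-- The bounded coset poset `Ĉ(H, G) = C(H, G) ⊔ {∅, G}`, ordered by inclusion. -/
abbrev BoundedCosetPoset {G : Type*} [Group G] (H : Subgroup G) : Type _ :=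
  {S : Set G // S = ∅ ∨ S = Set.univ ∨ IsProperCosetOver H S}

open Classical in
/-- The dual Euler totient `∑_{K ∈ [H, G]} μ(H, K) |G : K|`, where `μ` is the Möbius function of
the subgroup lattice (its value at `(H, K)` depends only on the interval `[H, K]`). -/
noncomputable def dualEulerTotient {G : Type*} [Group G] [Finite G] (H : Subgroup G) : ℤ :=
  letI : Fintype (Subgroup G) := Fintype.ofFinite _
  letI : LocallyFiniteOrder (Subgroup G) := Fintype.toLocallyFiniteOrder
  ∑ K ∈ Finset.Icc H ⊤, IncidenceAlgebra.mu ℤ H K * (K.index : ℤ)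

/-- A poset is connected if its comparability graph (the 1-skeleton of its order complex) is. -/
def IsConnectedPoset (P : Type*) [PartialOrder P] : Prop :=
  (SimpleGraph.fromRel (fun a b : P => a ≤ b)).Connected

/-- The space of chains of degree `n - 1` of the order complex of a finite poset `P`, over `ℂ`:
its standard basis is indexed by the faces `x₀ < ⋯ < xₙ₋₁` with `n` vertices. For `n = 0` the only
face is the empty one. -/
abbrev OrderChains (P : Type*) [PartialOrder P] (n : ℕ) : Type _ :=
  (Fin n ↪o P) → ℂ

instance finiteOrderEmbeddingFin (P : Type*) [PartialOrder P] [Finite P] (n : ℕ) :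
    Finite (Fin n ↪o P) :=
  DFunLike.finite _

open Classical in
/-- The boundary map from degree `n` to degree `n - 1`, given on the standard basis by
`∂ (x₀ < ⋯ < xₙ) = ∑ᵢ (-1)ⁱ (x₀ < ⋯ < x̂ᵢ < ⋯ < xₙ)`; for `n = 0` it is the augmentation. -/
noncomputable def orderBoundary (P : Type*) [PartialOrder P] [Finite P] (n : ℕ) :
    OrderChains P (n + 1) →ₗ[ℂ] OrderChains P n :=
  letI : Fintype (Fin (n + 1) ↪o P) := Fintype.ofFinite _
  Fintype.linearCombination ℂ fun c : Fin (n + 1) ↪o P =>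
    ∑ i : Fin (n + 1), Pi.single ((Fin.succAboveOrderEmb i).trans c) ((-1 : ℂ) ^ (i : ℕ))

/-- The reduced cycles of degree `n - 1` (everything in degree `-1`). -/
noncomputable def orderCycles (P : Type*) [PartialOrder P] [Finite P] :
    (n : ℕ) → Submodule ℂ (OrderChains P n)
  | 0 => ⊤
  | n + 1 => LinearMap.ker (orderBoundary P n)

/-- The dimension of the reduced homology of the order complex of `P` in degree `n - 1`:
cycles modulo boundaries. -/
noncomputable def reducedBettiShifted (P : Type*) [PartialOrder P] [Finite P] (n : ℕ) : ℕ :=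
  Module.finrank ℂ
    (orderCycles P n ⧸ (LinearMap.range (orderBoundary P n)).submoduleOf (orderCycles P n))

/-- The `i`-th reduced Betti number over `ℂ` of the order complex of the finite poset `P`
(it is `0` in degrees below `-1`). -/
noncomputable def reducedBetti (P : Type*) [PartialOrder P] [Finite P] (i : ℤ) : ℕ :=
  if -1 ≤ i then reducedBettiShifted P (i + 1).toNat else 0

/-- The dimension of the order complex of a finite poset: one less than the largest number of
elements in a chain, so `-1` for the empty poset. -/
noncomputable def orderComplexDim (P : Type*) [PartialOrder P] [Finite P] : ℤ :=
  ((sSup {n : ℕ | Nonempty (Fin n ↪o P)} : ℕ) : ℤ) - 1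

/-- A finite poset is graded if it is bounded and pure (all maximal chains have the same
length). -/
def IsGradedPoset (P : Type*) [PartialOrder P] [Finite P] : Prop :=
  (∃ x : P, IsBot x) ∧ (∃ y : P, IsTop y) ∧
    ∀ s t : Set P, IsMaxChain (· ≤ ·) s → IsMaxChain (· ≤ ·) t → s.ncard = t.ncard

/-- A finite graded poset is Cohen-Macaulay (over `ℂ`) if the reduced homology of the order
complex of every open interval vanishes below the dimension of this complex. -/
def IsCohenMacaulayPoset (P : Type*) [PartialOrder P] [Finite P] : Prop :=
  IsGradedPoset P ∧ ∀ x y : P, x < y → ∀ i : ℤ, i < orderComplexDim (Set.Ioo x y) →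
    reducedBetti (Set.Ioo x y) i = 0

/-!
The proof works with cosets as sets: `K g ⊆ L h` holds exactly when `K ≤ L` and `g h⁻¹ ∈ L`.

*Connectedness.* Every element `K g` of `C(H, G)` contains `H g`, so it is enough to join the cosets
of `H`. A singleton and its complement give proper subgroups `M, N ≥ H` that generate `G`
(`IsBooleanInterval.exists_sup_eq_top`). For `x` in `M` the cosets `H x g` and `H g` lie in `M g`,
and likewise for `N`; the `x` for which the two cosets are joined for all `g` form a subgroup, so it
is `G` (`isConnectedPoset_cosetPoset`).

*Rank two.* Now `[H, G] = {H, M, N, G}` (`IsDiamondInterval`), and the totient is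
`|G : H| - |G : M| - |G : N| + 1`. As `H < M` and `H < N`, both `|G : M|` and `|G : N|` are at most
`|G : H| / 2`, so the totient is positive. The poset `Ĉ(H, G)` has the rank function `0` on `∅`, `1`
on cosets of `H`, `2` on cosets of `M` and `N`, and `3` on `G`. Every maximal chain meets all four
ranks. For the Cohen–Macaulay property, only degrees `-1` and `0` are in question: an open interval
of dimension at least `0` is nonempty, and the only one of dimension `1` is `C(H, G)`, which is
connected (`isCohenMacaulayPoset_of_rank_three`).

Finally, `Δ(C(H, G))` is a graph with `2 |G : H|` edges and `|G : H| + |G : M| + |G : N|` vertices,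
which is at most `2 |G : H|`. The boundaries of edges lie in the kernel of the augmentation, of
dimension one less than the number of vertices, so rank-nullity produces a nonzero cycle
(`reducedBetti_one_ne_zero`).
-/

/-! ### Low-dimensional reduced homology of order complexes -/

section OrderHomology

variable {P : Type*} [PartialOrder P]

/-- The chain `a < b`, as an edge of the order complex. -/
def edgeOfLT {a b : P} (h : a < b) : Fin 2 ↪o P :=
  OrderEmbedding.ofStrictMono ![a, b] (by
    rw [Fin.strictMono_iff_lt_succ]
    intro i
    fin_cases i
    simpa using h)

/-- The element `a`, as a vertex of the order complex. -/
def vertexOf (a : P) : Fin 1 ↪o P :=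
  OrderEmbedding.ofStrictMono (fun _ => a) (fun i j h => absurd h (by
    rw [Subsingleton.elim i j]; exact lt_irrefl _))

@[simp] theorem vertexOf_apply (a : P) (i : Fin 1) : vertexOf a i = a := rfl

theorem eq_vertexOf (c : Fin 1 ↪o P) : c = vertexOf (c 0) := by
  ext i
  rw [Subsingleton.elim i 0, vertexOf_apply]

instance : Unique (Fin 0 ↪o P) where
  default := OrderEmbedding.ofStrictMono Fin.elim0 (fun i => i.elim0)
  uniq c := by ext i; exact i.elim0

variable [Finite P]

open Classical in
theorem orderBoundary_single (n : ℕ) (c : Fin (n + 1) ↪o P) (z : ℂ) :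
    orderBoundary P n (Pi.single c z) =
      z • ∑ i : Fin (n + 1), Pi.single ((Fin.succAboveOrderEmb i).trans c) ((-1 : ℂ) ^ (i : ℕ)) := by
  let _ : Fintype (Fin (n + 1) ↪o P) := Fintype.ofFinite _
  unfold orderBoundary
  convert Fintype.linearCombination_apply_single ℂ _ c z

open Classical in
theorem orderBoundary_vertex (c : Fin 1 ↪o P) (z : ℂ) :
    orderBoundary P 0 (Pi.single c z) = fun _ => z := by
  rw [orderBoundary_single]
  ext d
  simp [Subsingleton.elim d ((Fin.succAboveOrderEmb 0).trans c)]

open Classical in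
theorem orderBoundary_edge (c : Fin 2 ↪o P) (z : ℂ) :
    orderBoundary P 1 (Pi.single c z) =
      z • (Pi.single (vertexOf (c 1)) 1 - Pi.single (vertexOf (c 0)) 1) := by
  have h0 : (Fin.succAboveOrderEmb 0).trans c = vertexOf (c 1) := by
    rw [eq_vertexOf ((Fin.succAboveOrderEmb 0).trans c)]; rfl
  have h1 : (Fin.succAboveOrderEmb 1).trans c = vertexOf (c 0) := by
    rw [eq_vertexOf ((Fin.succAboveOrderEmb 1).trans c)]; rfl
  rw [orderBoundary_single, Fin.sum_univ_two, h0, h1, sub_eq_add_neg, ← Pi.single_neg]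
  simp

theorem orderBoundary_zero_apply [Fintype (Fin 1 ↪o P)] (f : OrderChains P 1)
    (d : Fin 0 ↪o P) : orderBoundary P 0 f d = ∑ c, f c := by
  classical
  conv_lhs => rw [← Finset.univ_sum_single f]
  rw [map_sum, Finset.sum_apply]
  simp [orderBoundary_vertex]

theorem range_orderBoundary_one_le :
    LinearMap.range (orderBoundary P 1) ≤ LinearMap.ker (orderBoundary P 0) := by
  classical
  let _ : Fintype (Fin 2 ↪o P) := Fintype.ofFinite _
  rintro _ ⟨f, rfl⟩
  rw [LinearMap.mem_ker, ← Finset.univ_sum_single f, map_sum, map_sum]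
  refine Finset.sum_eq_zero fun c _ => ?_
  rw [orderBoundary_edge, map_smul, map_sub, orderBoundary_vertex, orderBoundary_vertex, sub_self,
    smul_zero]

theorem orderBoundary_zero_surjective [Nonempty P] :
    Function.Surjective (orderBoundary P 0) := by
  classical
  intro f
  refine ⟨Pi.single (vertexOf (Classical.arbitrary P)) (f default), ?_⟩
  rw [orderBoundary_vertex]
  ext d
  rw [Subsingleton.elim d default]

/-- Reduced homology vanishes in a degree where every cycle is a boundary. -/
theorem reducedBettiShifted_eq_zero {n : ℕ}
    (h : orderCycles P n ≤ LinearMap.range (orderBoundary P n)) :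
    reducedBettiShifted P n = 0 := by
  have h' : (LinearMap.range (orderBoundary P n)).submoduleOf (orderCycles P n) = ⊤ :=
    Submodule.submoduleOf_eq_top.2 h
  unfold reducedBettiShifted
  rw [h']
  have := Submodule.Quotient.subsingleton_iff.2
    (rfl : (⊤ : Submodule ℂ (orderCycles P n)) = ⊤)
  exact Module.finrank_zero_of_subsingleton

theorem reducedBetti_neg_one [Nonempty P] : reducedBetti P (-1) = 0 := by
  rw [reducedBetti, if_pos le_rfl]
  refine reducedBettiShifted_eq_zero (n := 0) ?_
  rw [LinearMap.range_eq_top.2 orderBoundary_zero_surjective]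
  exact le_top

/-- A connected order complex has no reduced homology in degree `0`: along a walk, the difference
of its end points is the boundary of the sum of its edges. -/
theorem reducedBetti_zero_of_connected (h : IsConnectedPoset P) : reducedBetti P 0 = 0 := by
  classical
  let _ : Fintype (Fin 1 ↪o P) := Fintype.ofFinite _
  rw [reducedBetti, if_pos (by norm_num)]
  refine reducedBettiShifted_eq_zero (n := 1) ?_
  have hlt : ∀ {a b : P}, a < b →
      (Pi.single (vertexOf b) 1 - Pi.single (vertexOf a) 1 : OrderChains P 1) ∈
        LinearMap.range (orderBoundary P 1) := fun hab =>
    ⟨Pi.single (edgeOfLT hab) 1, by rw [orderBoundary_edge, one_smul]; rfl⟩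
  have hwalk : ∀ a b : P,
      (Pi.single (vertexOf b) 1 - Pi.single (vertexOf a) 1 : OrderChains P 1) ∈
        LinearMap.range (orderBoundary P 1) := by
    intro a b
    obtain ⟨w⟩ := h.preconnected a b
    induction w with
    | nil => rw [sub_self]; exact Submodule.zero_mem _
    | @cons u v w huv _ ih =>
      rw [SimpleGraph.fromRel_adj] at huv
      rw [← sub_add_sub_cancel _ (Pi.single (vertexOf v) 1 : OrderChains P 1)]
      refine Submodule.add_mem _ ih ?_
      rcases huv.2 with huv' | huv'
      · exact hlt (lt_of_le_of_ne huv' huv.1)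
      · rw [← neg_sub]
        exact Submodule.neg_mem _ (hlt (lt_of_le_of_ne huv' huv.1.symm))
  intro f hf
  obtain ⟨a⟩ := h.nonempty
  have hsum : ∑ c, f c = 0 := by
    rw [← orderBoundary_zero_apply f default, LinearMap.mem_ker.1 hf]; rfl
  have hf' : f = ∑ c : Fin 1 ↪o P,
      f c • (Pi.single (vertexOf (c 0)) 1 - Pi.single (vertexOf a) 1 : OrderChains P 1) := by
    simp only [smul_sub, Finset.sum_sub_distrib, ← Finset.sum_smul, hsum, zero_smul, sub_zero,
      ← eq_vertexOf]
    conv_lhs => rw [← Finset.univ_sum_single f]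
    refine Finset.sum_congr rfl fun c _ => ?_
    rw [← Pi.single_smul, smul_eq_mul, mul_one]
  rw [hf']
  exact Submodule.sum_mem _ fun c _ => Submodule.smul_mem _ _ (hwalk _ _)

/-- In a one-dimensional order complex with at least as many edges as vertices there is a cycle:
the boundaries of the edges span a space of dimension less than the number of vertices, because
the augmentation kills them. -/
theorem reducedBetti_one_ne_zero [Nonempty P] [IsEmpty (Fin 3 ↪o P)]
    (h : Nat.card P ≤ Nat.card (Fin 2 ↪o P)) : reducedBetti P 1 ≠ 0 := by
  rw [reducedBetti, if_pos (by norm_num)]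
  change reducedBettiShifted P 2 ≠ 0
  let _ : Fintype (Fin 1 ↪o P) := Fintype.ofFinite _
  let _ : Fintype (Fin 2 ↪o P) := Fintype.ofFinite _
  have hV : Nat.card (Fin 1 ↪o P) = Nat.card P :=
    Nat.card_congr ⟨fun c => c 0, vertexOf, fun c => (eq_vertexOf c).symm, fun _ => rfl⟩
  have hrange : LinearMap.range (orderBoundary P 2) = ⊥ := by
    rw [LinearMap.range_eq_bot]
    exact LinearMap.ext fun f => by rw [Subsingleton.elim f 0, map_zero, map_zero]
  have hsub : (LinearMap.range (orderBoundary P 2)).submoduleOf (orderCycles P 2) = ⊥ := by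
    rw [hrange]
    exact LinearMap.ker_eq_bot.2 (Submodule.subtype_injective _)
  have hquot : reducedBettiShifted P 2 = Module.finrank ℂ (LinearMap.ker (orderBoundary P 1)) := by
    unfold reducedBettiShifted
    rw [hsub]
    exact (Submodule.quotEquivOfEqBot ⊥ rfl).finrank_eq
  have h1 := LinearMap.finrank_range_add_finrank_ker (orderBoundary P 1)
  have h0 := LinearMap.finrank_range_add_finrank_ker (orderBoundary P 0)
  have hle : Module.finrank ℂ (LinearMap.range (orderBoundary P 1)) ≤
      Module.finrank ℂ (LinearMap.ker (orderBoundary P 0)) :=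
    Submodule.finrank_mono range_orderBoundary_one_le
  have hone : Module.finrank ℂ (LinearMap.range (orderBoundary P 0)) = 1 := by
    rw [LinearMap.range_eq_top.2 orderBoundary_zero_surjective, finrank_top,
      Module.finrank_fintype_fun_eq_card, Fintype.card_unique]
  rw [Module.finrank_fintype_fun_eq_card, ← Nat.card_eq_fintype_card] at h0 h1
  change _ = Nat.card (Fin 1 ↪o P) at h0
  change _ = Nat.card (Fin 2 ↪o P) at h1
  omega

/-! ### Dimension of order complexes -/

theorem bddAbove_chain_lengths : BddAbove {n : ℕ | Nonempty (Fin n ↪o P)} := by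
  refine ⟨Nat.card P, ?_⟩
  rintro n ⟨c⟩
  simpa using Nat.card_le_card_of_injective c c.injective

/-- A poset whose order complex has dimension at least `k - 1` has a chain with `k` elements. -/
theorem exists_chain_of_le_orderComplexDim {k : ℕ} (h : (k : ℤ) - 1 ≤ orderComplexDim P) :
    Nonempty (Fin k ↪o P) := by
  unfold orderComplexDim at h
  have hmem : sSup {n : ℕ | Nonempty (Fin n ↪o P)} ∈ {n : ℕ | Nonempty (Fin n ↪o P)} :=
    Nat.sSup_mem ⟨0, ⟨default⟩⟩ bddAbove_chain_lengths
  obtain ⟨c⟩ := hmem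
  exact ⟨(Fin.castLEOrderEmb (by omega)).trans c⟩

theorem orderComplexDim_eq_one (h2 : Nonempty (Fin 2 ↪o P)) (h3 : IsEmpty (Fin 3 ↪o P)) :
    orderComplexDim P = 1 := by
  have hge : 2 ≤ sSup {n : ℕ | Nonempty (Fin n ↪o P)} := le_csSup bddAbove_chain_lengths h2
  have hle : ¬ (2 ≤ orderComplexDim P) := fun h =>
    not_isEmpty_iff.2 (exists_chain_of_le_orderComplexDim (k := 3) (by simpa using h)) h3
  unfold orderComplexDim at hle ⊢
  omega

end OrderHomology

/-! ### Posets with a rank function onto `{0, 1, 2, 3}` -/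

section RankThree

variable {P : Type*} [PartialOrder P] [Finite P] [BoundedOrder P]

/-- A maximal chain meets every rank, if every element of rank at least `2` lies above one of
rank `1`, and every element of rank at most `1` lies below one of rank `2`. -/
theorem IsMaxChain.ncard_eq_four {r : P → ℕ} (hr : StrictMono r) (hbot : r ⊥ = 0)
    (htop : r ⊤ = 3) (hdown : ∀ x, 2 ≤ r x → ∃ y ≤ x, r y = 1)
    (hup : ∀ x, r x ≤ 1 → ∃ y, x ≤ y ∧ r y = 2) {s : Set P} (hs : IsMaxChain (· ≤ ·) s) :
    s.ncard = 4 := by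
  -- By maximality, an element comparable to all of `s` belongs to `s`.
  have hins : ∀ y, (∀ b ∈ s, y ≤ b ∨ b ≤ y) → y ∈ s := fun y hy => by
    rw [hs.2 (hs.1.insert fun b hb _ => hy b hb) (Set.subset_insert _ _)]
    exact Set.mem_insert _ _
  have hlt : ∀ {x y}, x ∈ s → y ∈ s → r x < r y → x ≤ y := fun hx hy hxy =>
    (hs.1.total hx hy).resolve_right fun hle => absurd (hr.monotone hle) (not_le.2 hxy)
  have hinj : Set.InjOn r s := fun x hx y hy hxy => by
    rcases hs.1.total hx hy with h | h
    · exact h.eq_of_not_lt fun h' => (hr h').ne hxy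
    · exact (h.eq_of_not_lt fun h' => (hr h').ne hxy.symm).symm
  have hbs : ⊥ ∈ s := hins ⊥ fun b _ => Or.inl bot_le
  have hts : ⊤ ∈ s := hins ⊤ fun b _ => Or.inr le_top
  have heqbot : ∀ x, r x = 0 → x = ⊥ := fun x hx => by
    by_contra hne
    have := hr (bot_lt_iff_ne_bot.2 hne)
    omega
  have hle3 : ∀ x, r x ≤ 3 := fun x => htop ▸ hr.monotone le_top
  have heqtop : ∀ x, r x = 3 → x = ⊤ := fun x hx => by
    by_contra hne
    have := hr (lt_top_iff_ne_top.2 hne)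
    omega
  have h1 : ∃ x ∈ s, r x = 1 := by
    by_contra! hno
    -- Otherwise an element of rank `1` below the least element `x` of rank at least `2` in `s`
    -- could be added to `s`.
    obtain ⟨x, ⟨hxs, hx2⟩, hxmin⟩ := Set.exists_min_image {x | x ∈ s ∧ 2 ≤ r x} r
      (Set.toFinite _) ⟨⊤, hts, by omega⟩
    obtain ⟨y, hyx, hy⟩ := hdown x hx2
    refine hno y (hins y fun b hb => ?_) hy
    rcases Nat.lt_or_ge (r b) 2 with hb2 | hb2
    · have := hno b hb
      rw [heqbot b (by omega)]
      exact Or.inr bot_le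
    · refine Or.inl (hyx.trans ?_)
      rcases (hxmin b ⟨hb, hb2⟩).lt_or_eq with h | h
      · exact hlt hxs hb h
      · exact (hinj hxs hb h).le
  obtain ⟨a, has, ha⟩ := h1
  have h2 : ∃ x ∈ s, r x = 2 := by
    by_contra! hno
    -- Otherwise `s` is `{⊥, a, ⊤}`, and an element of rank `2` above `a` could be added.
    obtain ⟨y, hay, hy⟩ := hup a ha.le
    refine hno y (hins y fun b hb => ?_) hy
    have hb3 := hle3 b
    have hb2 := hno b hb
    rcases Nat.lt_or_ge (r b) 2 with h | h
    · refine Or.inr (le_trans ?_ hay)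
      rcases (show r b ≤ r a by omega).lt_or_eq with h | h
      · exact hlt hb has h
      · exact (hinj hb has h).le
    · rw [heqtop b (by omega)]
      exact Or.inl le_top
  obtain ⟨b, hbs', hb⟩ := h2
  have himage : r '' s = (Finset.range 4 : Finset ℕ) := by
    ext k
    simp only [Set.mem_image, Finset.coe_range, Set.mem_Iio]
    constructor
    · rintro ⟨x, -, rfl⟩
      exact Nat.lt_succ_of_le (hle3 x)
    · intro hk
      interval_cases k
      exacts [⟨⊥, hbs, hbot⟩, ⟨a, has, ha⟩, ⟨b, hbs', hb⟩, ⟨⊤, hts, htop⟩]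
  rw [← hinj.ncard_image, himage, Set.ncard_coe_finset, Finset.card_range]

/-- A poset of rank `3` with connected proper part is Cohen-Macaulay: the open intervals of
dimension at least `0` are nonempty, and the only one of dimension `1` is the proper part. -/
theorem isCohenMacaulayPoset_of_rank_three {r : P → ℕ} (hr : StrictMono r) (hbot : r ⊥ = 0)
    (htop : r ⊤ = 3) (hdown : ∀ x, 2 ≤ r x → ∃ y ≤ x, r y = 1)
    (hup : ∀ x, r x ≤ 1 → ∃ y, x ≤ y ∧ r y = 2)
    (hconn : IsConnectedPoset (Set.Ioo (⊥ : P) ⊤)) : IsCohenMacaulayPoset P := by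
  refine ⟨⟨⟨⊥, fun _ => bot_le⟩, ⟨⊤, fun _ => le_top⟩, fun s t hs ht => ?_⟩, fun x y hxy i hi => ?_⟩
  · rw [hs.ncard_eq_four hr hbot htop hdown hup, ht.ncard_eq_four hr hbot htop hdown hup]
  · have hy3 : r y ≤ 3 := htop ▸ hr.monotone le_top
    rcases lt_trichotomy i (-1) with h | rfl | h
    · rw [reducedBetti, if_neg (by omega)]
    · obtain ⟨c⟩ := exists_chain_of_le_orderComplexDim (P := Set.Ioo x y) (k := 1) (by
        push_cast; omega)
      have : Nonempty (Set.Ioo x y) := ⟨c 0⟩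
      exact reducedBetti_neg_one
    · obtain ⟨c⟩ := exists_chain_of_le_orderComplexDim (P := Set.Ioo x y) (k := 2) (by
        push_cast; omega)
      have hx0 := hr (c 0).2.1
      have h01 := hr (show (c 0 : P) < c 1 from c.strictMono Fin.zero_lt_one)
      have h1y := hr (c 1).2.2
      rcases (show 0 ≤ i by omega).eq_or_lt with rfl | h'
      -- A chain of two elements in `(x, y)` forces `x` and `y` to have ranks `0` and `3`.
      · have hx : x = ⊥ := by
          by_contra hne
          have := hr (bot_lt_iff_ne_bot.2 hne)
          omega
        have hy : y = ⊤ := by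
          by_contra hne
          have := hr (lt_top_iff_ne_top.2 hne)
          omega
        subst hx hy
        exact reducedBetti_zero_of_connected hconn
      · obtain ⟨d⟩ := exists_chain_of_le_orderComplexDim (P := Set.Ioo x y) (k := 3) (by
          push_cast; omega)
        have e0 := hr (d 0).2.1
        have e1 := hr (show (d 0 : P) < d 1 from d.strictMono (by decide))
        have e2 := hr (show (d 1 : P) < d 2 from d.strictMono (by decide))
        have e3 := hr (d 2).2.2
        omega

end RankThree

theorem IsConnectedPoset.of_orderIso {P Q : Type*} [PartialOrder P] [PartialOrder Q]
    (e : P ≃o Q) (h : IsConnectedPoset P) : IsConnectedPoset Q := by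
  refine (SimpleGraph.Iso.connected_iff ⟨e.toEquiv, ?_⟩).1 h
  intro a b
  simp

/-! ### Right cosets as sets -/

section RightCosets

variable {G : Type*} [Group G]

/-- The right coset `K g`, as a set. -/
def rightCosetSet (K : Subgroup G) (g : G) : Set G := (fun k => k * g) '' (K : Set G)

theorem mem_rightCosetSet {K : Subgroup G} {g x : G} :
    x ∈ rightCosetSet K g ↔ x * g⁻¹ ∈ K := by
  constructor
  · rintro ⟨k, hk, rfl⟩
    simpa using hk
  · exact fun h => ⟨x * g⁻¹, h, by simp⟩

theorem rightCosetSet_subset_iff {K L : Subgroup G} {g h : G} :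
    rightCosetSet K g ⊆ rightCosetSet L h ↔ K ≤ L ∧ g * h⁻¹ ∈ L := by
  constructor
  · intro hs
    have hg : g * h⁻¹ ∈ L :=
      mem_rightCosetSet.1 (hs (mem_rightCosetSet.2 (by simp)))
    refine ⟨fun k hk => ?_, hg⟩
    have := mem_rightCosetSet.1 (hs (mem_rightCosetSet.2 (show k * g * g⁻¹ ∈ K by simpa using hk)))
    rwa [mul_assoc, L.mul_mem_cancel_right hg] at this
  · rintro ⟨hKL, hg⟩ x hx
    rw [mem_rightCosetSet] at hx ⊢
    simpa [mul_assoc] using L.mul_mem (hKL hx) hg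

theorem rightCosetSet_eq_iff {K L : Subgroup G} {g h : G} :
    rightCosetSet K g = rightCosetSet L h ↔ K = L ∧ g * h⁻¹ ∈ L := by
  rw [Set.Subset.antisymm_iff, rightCosetSet_subset_iff, rightCosetSet_subset_iff]
  constructor
  · rintro ⟨⟨h1, h2⟩, h3, -⟩
    exact ⟨le_antisymm h1 h3, h2⟩
  · rintro ⟨rfl, h2⟩
    exact ⟨⟨le_rfl, h2⟩, le_rfl, by simpa using K.inv_mem h2⟩

theorem rightCosetSet_nonempty (K : Subgroup G) (g : G) : (rightCosetSet K g).Nonempty :=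
  ⟨g, mem_rightCosetSet.2 (by simp)⟩

theorem rightCosetSet_top (g : G) : rightCosetSet ⊤ g = Set.univ :=
  Set.eq_univ_of_forall fun _ => mem_rightCosetSet.2 (Subgroup.mem_top _)

theorem rightCosetSet_mono {K L : Subgroup G} (h : K ≤ L) (g : G) :
    rightCosetSet K g ⊆ rightCosetSet L g :=
  rightCosetSet_subset_iff.2 ⟨h, by simp⟩

theorem ncard_range_rightCosetSet (K : Subgroup G) :
    (Set.range (rightCosetSet K)).ncard = K.index := by
  have hiff : ∀ a b : G, rightCosetSet K a⁻¹ = rightCosetSet K b⁻¹ ↔ a⁻¹ * b ∈ K := fun a b => by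
    rw [rightCosetSet_eq_iff, inv_inv]
    exact and_iff_right rfl
  let f : G ⧸ K → Set G := Quotient.lift (fun g => rightCosetSet K g⁻¹) fun a b hab =>
    (hiff a b).2 (QuotientGroup.leftRel_apply.1 hab)
  have hf : Function.Injective f := by
    rintro ⟨a⟩ ⟨b⟩ hab
    exact QuotientGroup.eq.2 ((hiff a b).1 hab)
  have hrange : Set.range (rightCosetSet K) = Set.range f := by
    ext S
    constructor
    · rintro ⟨g, rfl⟩
      exact ⟨(g⁻¹ : G), congrArg (rightCosetSet K) (inv_inv g)⟩
    · rintro ⟨⟨g⟩, rfl⟩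
      exact ⟨g⁻¹, rfl⟩
  rw [hrange, ← Nat.card_coe_set_eq, Nat.card_range_of_injective hf, Subgroup.index]

end RightCosets

/-! ### Boolean intervals -/

section Boolean

variable {G : Type*} [Group G] {H : Subgroup G}

/-- Two complementary proper elements: a singleton and its complement. -/
theorem IsBooleanInterval.exists_sup_eq_top {n : ℕ} (hn : 2 ≤ n) (h : IsBooleanInterval H n) :
    ∃ M N : Subgroup G, H ≤ M ∧ H ≤ N ∧ M < ⊤ ∧ N < ⊤ ∧ M ⊔ N = ⊤ := by
  obtain ⟨e⟩ := h
  have hlt : ∀ s : Finset (Fin n), s ≠ Finset.univ → (e.symm s : Subgroup G) < ⊤ := by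
    intro s hs
    refine lt_top_iff_ne_top.2 fun htop => hs (Finset.univ_subset_iff.1 ?_)
    rw [← e.symm.le_iff_le, ← Subtype.coe_le_coe, htop]
    exact le_top
  let i : Fin n := ⟨0, by omega⟩
  let j : Fin n := ⟨1, by omega⟩
  have hij : j ≠ i := by simp [i, j]
  refine ⟨e.symm {i}, e.symm {i}ᶜ, (e.symm _).2.1, (e.symm _).2.1, hlt _ fun hi => ?_,
    hlt _ fun hi => ?_, ?_⟩
  · exact hij (Finset.mem_singleton.1 (hi ▸ Finset.mem_univ j))
  · have := hi ▸ Finset.mem_univ i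
    simp at this
  · let K : Set.Icc H (⊤ : Subgroup G) :=
      ⟨e.symm {i} ⊔ e.symm {i}ᶜ, (e.symm {i}).2.1.trans le_sup_left, le_top⟩
    have h1 : {i} ≤ e K := by
      rw [← e.symm_apply_le]; exact Subtype.coe_le_coe.1 le_sup_left
    have h2 : {i}ᶜ ≤ e K := by
      rw [← e.symm_apply_le]; exact Subtype.coe_le_coe.1 le_sup_right
    have h3 : e K = ⊤ := top_le_iff.1 (by
      rw [← sup_compl_eq_top (x := ({i} : Finset (Fin n)))]; exact sup_le h1 h2)
    have h4 : (⟨⊤, K.2.1.trans le_top, le_rfl⟩ : Set.Icc H (⊤ : Subgroup G)) ≤ K := by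
      rw [← e.le_iff_le, h3]; exact le_top
    exact top_le_iff.1 h4

/-- The interval `[H, G]` consists of `H`, `G` and two incomparable subgroups `M`, `N`. -/
structure IsDiamondInterval (H M N : Subgroup G) : Prop where
  lt_left : H < M
  lt_right : H < N
  left_lt_top : M < ⊤
  right_lt_top : N < ⊤
  not_left_le : ¬ M ≤ N
  not_right_le : ¬ N ≤ M
  eq_or : ∀ K, H ≤ K → K = H ∨ K = M ∨ K = N ∨ K = ⊤

theorem IsBooleanInterval.exists_isDiamondInterval (h : IsBooleanInterval H 2) :
    ∃ M N : Subgroup G, IsDiamondInterval H M N := by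
  obtain ⟨e⟩ := h
  have hbot : (e.symm ∅ : Subgroup G) = H := by
    refine le_antisymm ?_ (e.symm ∅).2.1
    have : e.symm ∅ ≤ ⟨H, le_rfl, le_top⟩ := by
      rw [e.symm_apply_le]; exact Finset.empty_subset _
    exact this
  have htop : (e.symm Finset.univ : Subgroup G) = ⊤ := by
    refine top_le_iff.1 ?_
    have : ⟨⊤, le_top, le_rfl⟩ ≤ e.symm Finset.univ := by
      rw [e.le_symm_apply]; exact Finset.subset_univ _
    exact this
  have hle : ∀ s t, (e.symm s : Subgroup G) ≤ e.symm t ↔ s ⊆ t := fun s t => by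
    rw [Subtype.coe_le_coe, e.symm.le_iff_le]
  have hlt : ∀ s t, (e.symm s : Subgroup G) < e.symm t ↔ s ⊂ t := fun s t => by
    rw [Subtype.coe_lt_coe, e.symm.lt_iff_lt]
  refine ⟨e.symm {0}, e.symm {1}, ?_, ?_, ?_, ?_, ?_, ?_, fun K hK => ?_⟩
  · conv_lhs => rw [← hbot]
    rw [hlt]; decide
  · conv_lhs => rw [← hbot]
    rw [hlt]; decide
  · refine lt_of_lt_of_eq ((hlt _ Finset.univ).2 ?_) htop; decide
  · refine lt_of_lt_of_eq ((hlt _ Finset.univ).2 ?_) htop; decide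
  · rw [hle]; decide
  · rw [hle]; decide
  · have hfin : ∀ s : Finset (Fin 2), s = ∅ ∨ s = {0} ∨ s = {1} ∨ s = Finset.univ := by decide
    have hK' : (e.symm (e ⟨K, hK, le_top⟩) : Subgroup G) = K := by rw [e.symm_apply_apply]
    rcases hfin (e ⟨K, hK, le_top⟩) with h | h | h | h <;> rw [h] at hK'
    · exact Or.inl (hK'.symm.trans hbot)
    · exact Or.inr (Or.inl hK'.symm)
    · exact Or.inr (Or.inr (Or.inl hK'.symm))
    · exact Or.inr (Or.inr (Or.inr (hK'.symm.trans htop)))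

end Boolean

/-! ### Connectedness of the coset poset -/

section Connected

variable {G : Type*} [Group G] {H : Subgroup G}

/-- The right coset `K g`, as an element of the coset poset. -/
def CosetPoset.ofCoset {K : Subgroup G} (hK : H ≤ K) (hK' : K < ⊤) (g : G) : CosetPoset H :=
  ⟨rightCosetSet K g, K, hK, hK', g, rfl⟩

/-- If `G` is generated by two proper subgroups `M` and `N` above `H`, then `C(H, G)` is connected.
The elements `x` such that `H x g` and `H g` are joined by a path for all `g` are closed under
products and inverses, and they include `M` and `N`: for `x ∈ M`, both cosets lie in `M g`. -/
theorem isConnectedPoset_cosetPoset {M N : Subgroup G} (hHM : H ≤ M) (hHN : H ≤ N) (hM : M < ⊤)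
    (hN : N < ⊤) (hsup : M ⊔ N = ⊤) : IsConnectedPoset (CosetPoset H) := by
  have hH : H < ⊤ := hHM.trans_lt hM
  let Γ := SimpleGraph.fromRel (fun a b : CosetPoset H => a ≤ b)
  have hreach : ∀ {a b : CosetPoset H}, a ≤ b → Γ.Reachable a b := fun {a b} hab => by
    by_cases hne : a = b
    · rw [hne]
    · exact SimpleGraph.Adj.reachable ((SimpleGraph.fromRel_adj _ _ _).2 ⟨hne, Or.inl hab⟩)
  let v : G → CosetPoset H := fun g => CosetPoset.ofCoset le_rfl hH g
  let S : Subgroup G :=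
    { carrier := {x | ∀ g, Γ.Reachable (v (x * g)) (v g)}
      one_mem' := fun g => by rw [one_mul]
      mul_mem' := fun {x y} hx hy g => by
        rw [mul_assoc]; exact (hx (y * g)).trans (hy g)
      inv_mem' := fun {x} hx g => by
        have := hx (x⁻¹ * g)
        rw [mul_inv_cancel_left] at this
        exact this.symm }
  have hS : ∀ {K : Subgroup G}, H ≤ K → K < ⊤ → K ≤ S := fun {K} hHK hK x hx g => by
    have h1 : v (x * g) ≤ CosetPoset.ofCoset hHK hK g :=
      rightCosetSet_subset_iff.2 ⟨hHK, by simpa using hx⟩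
    have h2 : v g ≤ CosetPoset.ofCoset hHK hK g := rightCosetSet_mono hHK g
    exact (hreach h1).trans (hreach h2).symm
  have hStop : S = ⊤ := top_le_iff.1 (hsup ▸ sup_le (hS hHM hM) (hS hHN hN))
  have hone : ∀ a : CosetPoset H, Γ.Reachable a (v 1) := by
    rintro ⟨_, K, hHK, hK, g, rfl⟩
    have h1 : v g ≤ CosetPoset.ofCoset hHK hK g := rightCosetSet_mono hHK g
    refine (hreach h1).symm.trans ?_
    have h2 : g ∈ S := hStop ▸ Subgroup.mem_top g
    simpa using h2 1
  exact { preconnected := fun a b => (hone a).trans (hone b).symm, nonempty := ⟨v 1⟩ }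

end Connected

/-! ### The coset poset of an interval of rank two -/

section Diamond

variable {G : Type*} [Group G] {H M N : Subgroup G}

namespace IsDiamondInterval

theorem lt_top (h : IsDiamondInterval H M N) : H < ⊤ := h.lt_left.trans h.left_lt_top

theorem symm (h : IsDiamondInterval H M N) : IsDiamondInterval H N M :=
  ⟨h.lt_right, h.lt_left, h.right_lt_top, h.left_lt_top, h.not_right_le, h.not_left_le,
    fun K hK => by rcases h.eq_or K hK with h | h | h | h <;> simp [h]⟩

theorem sup_eq_top (h : IsDiamondInterval H M N) : M ⊔ N = ⊤ := by
  rcases h.eq_or (M ⊔ N) (h.lt_left.le.trans le_sup_left) with h' | h' | h' | h'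
  · exact absurd (h' ▸ le_sup_left) h.lt_left.not_ge
  · exact absurd (h' ▸ le_sup_right) h.not_right_le
  · exact absurd (h' ▸ le_sup_left) h.not_left_le
  · exact h'

/-- A chain `H < K < L` of subgroups can only end at `G`. -/
theorem eq_top_of_lt_of_lt (h : IsDiamondInterval H M N) {K L : Subgroup G} (hHK : H < K)
    (hKL : K < L) : L = ⊤ := by
  rcases h.eq_or K hHK.le with rfl | rfl | rfl | rfl
  · exact absurd hHK (lt_irrefl _)
  · rcases h.eq_or L (hHK.trans hKL).le with rfl | rfl | rfl | rfl
    exacts [absurd hHK (lt_asymm hKL), absurd hKL (lt_irrefl _), absurd hKL.le h.not_left_le, rfl]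
  · rcases h.eq_or L (hHK.trans hKL).le with rfl | rfl | rfl | rfl
    exacts [absurd hHK (lt_asymm hKL), absurd hKL.le h.not_right_le, absurd hKL (lt_irrefl _), rfl]
  · exact absurd hKL not_top_lt

theorem two_mul_index_le [Finite G] (h : IsDiamondInterval H M N) : 2 * M.index ≤ H.index := by
  rw [← Subgroup.relIndex_mul_index h.lt_left.le]
  refine Nat.mul_le_mul_right _ ?_
  have h0 : H.relIndex M ≠ 0 := Subgroup.index_ne_zero_of_finite
  have h1 : H.relIndex M ≠ 1 := fun h' =>
    absurd (Subgroup.relIndex_eq_one.1 h') h.lt_left.not_ge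
  omega

theorem index_add_index_le [Finite G] (h : IsDiamondInterval H M N) :
    M.index + N.index ≤ H.index := by
  have := h.two_mul_index_le
  have := h.symm.two_mul_index_le
  omega

/-- Each of the `|G : H|` cosets of `H` lies in a coset of `M` and in one of `N`, which makes
`2 |G : H|` edges, at least the number `|G : H| + |G : M| + |G : N|` of all cosets. -/
theorem card_cosetPoset_le [Finite G] (h : IsDiamondInterval H M N) :
    Nat.card (CosetPoset H) ≤ Nat.card (Fin 2 ↪o CosetPoset H) := by
  have hV : Nat.card (CosetPoset H) ≤ H.index + M.index + N.index := by
    have hsub : {S : Set G | IsProperCosetOver H S} ⊆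
        Set.range (rightCosetSet H) ∪ Set.range (rightCosetSet M) ∪
          Set.range (rightCosetSet N) := by
      rintro _ ⟨K, hHK, hK, g, rfl⟩
      rcases h.eq_or K hHK with rfl | rfl | rfl | rfl
      · exact Or.inl (Or.inl ⟨g, rfl⟩)
      · exact Or.inl (Or.inr ⟨g, rfl⟩)
      · exact Or.inr ⟨g, rfl⟩
      · exact absurd hK (lt_irrefl _)
    rw [← ncard_range_rightCosetSet H, ← ncard_range_rightCosetSet M,
      ← ncard_range_rightCosetSet N]
    exact (Set.ncard_le_ncard hsub (Set.toFinite _)).trans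
      ((Set.ncard_union_le _ _).trans (Nat.add_le_add_right (Set.ncard_union_le _ _) _))
  have hE : 2 * H.index ≤ Nat.card (Fin 2 ↪o CosetPoset H) := by
    -- The edges `H g < M g` and `H g < N g`, for one representative `g` of each coset of `H`.
    choose g hg using fun S : Set.range (rightCosetSet H) => S.2
    let L : Bool → Subgroup G := fun b => if b then M else N
    have hL : ∀ b, H < L b := by rintro (_ | _); exacts [h.lt_right, h.lt_left]
    have hL' : ∀ b, L b < ⊤ := by rintro (_ | _); exacts [h.right_lt_top, h.left_lt_top]
    have hlt : ∀ b x,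
        CosetPoset.ofCoset le_rfl h.lt_top x < CosetPoset.ofCoset (hL b).le (hL' b) x :=
      fun b x => lt_of_le_of_ne (rightCosetSet_mono (hL b).le x) fun he =>
        (hL b).ne (rightCosetSet_eq_iff.1 (congrArg Subtype.val he)).1
    let f : Bool × Set.range (rightCosetSet H) → (Fin 2 ↪o CosetPoset H) :=
      fun p => edgeOfLT (hlt p.1 (g p.2))
    have hf : Function.Injective f := by
      rintro ⟨b, S⟩ ⟨c, T⟩ hbc
      have h0 : rightCosetSet H (g S) = rightCosetSet H (g T) :=
        congrArg Subtype.val (DFunLike.congr_fun hbc 0)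
      have h1 : rightCosetSet (L b) (g S) = rightCosetSet (L c) (g T) :=
        congrArg Subtype.val (DFunLike.congr_fun hbc 1)
      rw [hg, hg] at h0
      have hne : M ≠ N := fun he => h.not_left_le he.le
      refine Prod.ext ?_ (Subtype.ext h0)
      have h2 := (rightCosetSet_eq_iff.1 h1).1
      cases b <;> cases c <;> simp [L, hne, hne.symm] at h2 ⊢
    have := Nat.card_le_card_of_injective f hf
    rwa [Nat.card_prod, Nat.card_eq_two_iff.2 ⟨true, false, by simp, by ext b; cases b <;> simp⟩,
      Nat.card_coe_set_eq, ncard_range_rightCosetSet] at this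
  have := h.index_add_index_le
  omega

end IsDiamondInterval

instance : BoundedOrder (BoundedCosetPoset H) where
  top := ⟨Set.univ, Or.inr (Or.inl rfl)⟩
  le_top S := Set.subset_univ S.1
  bot := ⟨∅, Or.inl rfl⟩
  bot_le S := Set.empty_subset S.1

namespace BoundedCosetPoset

/-- The rank function of the bounded coset poset: `0` at `∅`, `1` at the cosets of `H`, `3` at `G`
and `2` at all other cosets. -/
noncomputable def rank (S : BoundedCosetPoset H) : ℕ :=
  open Classical in
  if S.1 = ∅ then 0 else if S.1 = Set.univ then 3 else
    if S.1 ∈ Set.range (rightCosetSet H) then 1 else 2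

theorem eq_bot_or_eq_top_or (S : BoundedCosetPoset H) :
    S = ⊥ ∨ S = ⊤ ∨ ∃ K g, H ≤ K ∧ K < ⊤ ∧ S.1 = rightCosetSet K g := by
  rcases S with ⟨S, rfl | rfl | ⟨K, hHK, hK, g, rfl⟩⟩
  · exact Or.inl rfl
  · exact Or.inr (Or.inl rfl)
  · exact Or.inr (Or.inr ⟨K, g, hHK, hK, rfl⟩)

theorem rank_bot : rank (⊥ : BoundedCosetPoset H) = 0 := if_pos rfl

theorem rank_top : rank (⊤ : BoundedCosetPoset H) = 3 := by
  exact (if_neg Set.univ_nonempty.ne_empty).trans (if_pos rfl)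

theorem rightCosetSet_ne_univ {K : Subgroup G} (hK : K < ⊤) (g : G) :
    rightCosetSet K g ≠ Set.univ := fun h => by
  rw [← rightCosetSet_top 1] at h
  exact hK.ne (rightCosetSet_eq_iff.1 h).1

theorem rank_eq_one (hH : H < ⊤) {S : BoundedCosetPoset H} {g : G}
    (hS : S.1 = rightCosetSet H g) : rank S = 1 := by
  rw [rank, if_neg (hS ▸ (rightCosetSet_nonempty H g).ne_empty),
    if_neg (hS ▸ rightCosetSet_ne_univ hH g), if_pos ⟨g, hS.symm⟩]

theorem rank_eq_two {K : Subgroup G} (hK : H < K) (hK' : K < ⊤) {S : BoundedCosetPoset H} {g : G}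
    (hS : S.1 = rightCosetSet K g) : rank S = 2 := by
  rw [rank, if_neg (hS ▸ (rightCosetSet_nonempty K g).ne_empty),
    if_neg (hS ▸ rightCosetSet_ne_univ hK' g), if_neg]
  rintro ⟨x, hx⟩
  exact hK.ne (rightCosetSet_eq_iff.1 (hx.trans hS)).1

theorem rank_strictMono (h : IsDiamondInterval H M N) :
    StrictMono (rank : BoundedCosetPoset H → ℕ) := by
  intro S T hST
  rcases eq_bot_or_eq_top_or S with rfl | rfl | ⟨K, a, hHK, hK, hS⟩
  · rw [rank_bot]
    rcases eq_bot_or_eq_top_or T with rfl | rfl | ⟨L, b, hHL, hL, hT⟩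
    · exact absurd hST (lt_irrefl _)
    · rw [rank_top]; norm_num
    · rcases hHL.eq_or_lt with rfl | hHL
      · rw [rank_eq_one hL hT]; norm_num
      · rw [rank_eq_two hHL hL hT]; norm_num
  · exact absurd hST not_top_lt
  · rcases eq_bot_or_eq_top_or T with rfl | rfl | ⟨L, b, hHL, hL, hT⟩
    · exact absurd hST not_lt_bot
    · rw [rank_top]
      rcases hHK.eq_or_lt with rfl | hHK
      · rw [rank_eq_one hK hS]; norm_num
      · rw [rank_eq_two hHK hK hS]; norm_num
    · have hsub : rightCosetSet K a ⊆ rightCosetSet L b := hS ▸ hT ▸ hST.le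
      obtain ⟨hKL, hab⟩ := rightCosetSet_subset_iff.1 hsub
      have hKL' : K < L := hKL.lt_of_ne fun he => hST.ne (Subtype.ext (by
        rw [hS, hT, rightCosetSet_eq_iff]; exact ⟨he, hab⟩))
      rcases hHK.eq_or_lt with rfl | hHK
      · rw [rank_eq_one hK hS, rank_eq_two hKL' hL hT]; norm_num
      · exact absurd (h.eq_top_of_lt_of_lt hHK hKL') hL.ne

theorem exists_le_rank_eq_one (hH : H < ⊤) (S : BoundedCosetPoset H) (hS : 2 ≤ rank S) :
    ∃ T ≤ S, rank T = 1 := by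
  have hcoset : ∀ g, ∃ T : BoundedCosetPoset H, T.1 = rightCosetSet H g := fun g =>
    ⟨⟨rightCosetSet H g, Or.inr (Or.inr ⟨H, le_rfl, hH, g, rfl⟩)⟩, rfl⟩
  rcases eq_bot_or_eq_top_or S with rfl | rfl | ⟨K, a, hHK, hK, hSK⟩
  · rw [rank_bot] at hS; omega
  · obtain ⟨T, hT⟩ := hcoset 1
    exact ⟨T, le_top, rank_eq_one hH hT⟩
  · obtain ⟨T, hT⟩ := hcoset a
    refine ⟨T, ?_, rank_eq_one hH hT⟩
    rw [← Subtype.coe_le_coe, hT, hSK]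
    exact rightCosetSet_mono hHK a

theorem exists_ge_rank_eq_two (h : IsDiamondInterval H M N) (S : BoundedCosetPoset H)
    (hS : rank S ≤ 1) : ∃ T, S ≤ T ∧ rank T = 2 := by
  have hcoset : ∀ g, ∃ T : BoundedCosetPoset H, T.1 = rightCosetSet M g := fun g =>
    ⟨⟨rightCosetSet M g, Or.inr (Or.inr ⟨M, h.lt_left.le, h.left_lt_top, g, rfl⟩)⟩, rfl⟩
  rcases eq_bot_or_eq_top_or S with rfl | rfl | ⟨K, a, hHK, hK, hSK⟩
  · obtain ⟨T, hT⟩ := hcoset 1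
    exact ⟨T, bot_le, rank_eq_two h.lt_left h.left_lt_top hT⟩
  · rw [rank_top] at hS; omega
  · rcases hHK.eq_or_lt with rfl | hHK
    · obtain ⟨T, hT⟩ := hcoset a
      refine ⟨T, ?_, rank_eq_two h.lt_left h.left_lt_top hT⟩
      rw [← Subtype.coe_le_coe, hT, hSK]
      exact rightCosetSet_mono h.lt_left.le a
    · rw [rank_eq_two hHK hK hSK] at hS; omega

/-- The coset poset is the proper part of the bounded coset poset. -/
def properPartIso (H : Subgroup G) :
    CosetPoset H ≃o Set.Ioo (⊥ : BoundedCosetPoset H) ⊤ where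
  toFun S := ⟨⟨S.1, Or.inr (Or.inr S.2)⟩, by
    obtain ⟨_, K, hHK, hK, g, rfl⟩ := S
    constructor
    · exact bot_lt_iff_ne_bot.2 fun he =>
        (rightCosetSet_nonempty K g).ne_empty (congrArg Subtype.val he)
    · exact lt_top_iff_ne_top.2 fun he =>
        rightCosetSet_ne_univ hK g (congrArg Subtype.val he)⟩
  invFun S := ⟨S.1.1, (S.1.2.resolve_left fun he => S.2.1.ne' (Subtype.ext he)).resolve_left
    fun he => S.2.2.ne (Subtype.ext he)⟩
  left_inv _ := rfl
  right_inv _ := rfl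
  map_rel_iff' := Iff.rfl

end BoundedCosetPoset

theorem IsDiamondInterval.isEmpty_chain_three (h : IsDiamondInterval H M N) :
    IsEmpty (Fin 3 ↪o CosetPoset H) := by
  refine ⟨fun c => ?_⟩
  have hr : StrictMono fun S : CosetPoset H =>
      BoundedCosetPoset.rank (BoundedCosetPoset.properPartIso H S : BoundedCosetPoset H) :=
    fun S T hST => BoundedCosetPoset.rank_strictMono h
      ((BoundedCosetPoset.properPartIso H).strictMono hST)
  have e0 := BoundedCosetPoset.rank_strictMono h (BoundedCosetPoset.properPartIso H (c 0)).2.1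
  have e1 := hr (c.strictMono (show (0 : Fin 3) < 1 by decide))
  have e2 := hr (c.strictMono (show (1 : Fin 3) < 2 by decide))
  have e3 := BoundedCosetPoset.rank_strictMono h (BoundedCosetPoset.properPartIso H (c 2)).2.2
  rw [BoundedCosetPoset.rank_bot] at e0
  rw [BoundedCosetPoset.rank_top] at e3
  dsimp only at e1 e2
  omega

/-! ### The dual Euler totient of an interval of rank two -/

/-- The Möbius function of a four-element diamond takes the values `1, -1, -1, 1`. -/
theorem IsDiamondInterval.dualEulerTotient_eq [Finite G] (h : IsDiamondInterval H M N) :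
    dualEulerTotient H = (H.index : ℤ) - M.index - N.index + 1 := by
  classical
  unfold dualEulerTotient
  let _ : Fintype (Subgroup G) := Fintype.ofFinite _
  let _ : LocallyFiniteOrder (Subgroup G) := Fintype.toLocallyFiniteOrder
  have hHM := h.lt_left
  have hHN := h.lt_right
  have hMN : M ≠ N := fun he => h.not_left_le he.le
  have hIcc : Finset.Icc H ⊤ = {H, M, N, ⊤} := by
    ext K
    simp only [Finset.mem_Icc, Finset.mem_insert, Finset.mem_singleton]
    constructor
    · exact fun hK => h.eq_or K hK.1
    · rintro (rfl | rfl | rfl | rfl)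
      exacts [⟨le_rfl, le_top⟩, ⟨hHM.le, le_top⟩, ⟨hHN.le, le_top⟩, ⟨le_top, le_rfl⟩]
  have hIcoM : ∀ {M N : Subgroup G}, IsDiamondInterval H M N → Finset.Ico H M = {H} := by
    intro M N h
    ext K
    simp only [Finset.mem_Ico, Finset.mem_singleton]
    constructor
    · rintro ⟨hHK, hKM⟩
      by_contra hne
      exact h.left_lt_top.ne (h.eq_top_of_lt_of_lt (hHK.lt_of_ne (Ne.symm hne)) hKM)
    · rintro rfl
      exact ⟨le_rfl, h.lt_left⟩
  have hIcoT : Finset.Ico H ⊤ = {H, M, N} := by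
    ext K
    simp only [Finset.mem_Ico, Finset.mem_insert, Finset.mem_singleton]
    constructor
    · rintro ⟨hHK, hK⟩
      rcases h.eq_or K hHK with h' | h' | h' | h'
      exacts [Or.inl h', Or.inr (Or.inl h'), Or.inr (Or.inr h'), absurd h' hK.ne]
    · rintro (rfl | rfl | rfl)
      exacts [⟨le_rfl, h.lt_top⟩, ⟨hHM.le, h.left_lt_top⟩, ⟨hHN.le, h.right_lt_top⟩]
  have hmuM : ∀ {M N : Subgroup G}, IsDiamondInterval H M N →
      IncidenceAlgebra.mu ℤ H M = -1 := fun {M N} h => by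
    rw [IncidenceAlgebra.mu_eq_neg_sum_Ico_of_ne h.lt_left.ne, hIcoM h, Finset.sum_singleton,
      IncidenceAlgebra.mu_self]
  have hnot : H ∉ ({M, N} : Finset (Subgroup G)) := by simp [hHM.ne, hHN.ne]
  have hmuT : IncidenceAlgebra.mu ℤ H ⊤ = 1 := by
    rw [IncidenceAlgebra.mu_eq_neg_sum_Ico_of_ne h.lt_top.ne, hIcoT,
      Finset.sum_insert hnot, Finset.sum_pair hMN, hmuM h, hmuM h.symm, IncidenceAlgebra.mu_self]
    norm_num
  rw [hIcc, Finset.sum_insert (by simp [hHM.ne, hHN.ne, h.lt_top.ne]),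
    Finset.sum_insert (by simp [hMN, h.left_lt_top.ne]), Finset.sum_pair h.right_lt_top.ne,
    hmuT, hmuM h, hmuM h.symm, IncidenceAlgebra.mu_self, Subgroup.index_top]
  push_cast
  ring

end Diamond

theorem corollary4p15 {G : Type*} [Group G] [Finite G] (H : Subgroup G) :
    (∀ n : ℕ, 2 ≤ n → IsBooleanInterval H n → IsConnectedPoset (CosetPoset H)) ∧
    (IsBooleanInterval H 2 →
      1 ≤ dualEulerTotient H ∧
      IsCohenMacaulayPoset (BoundedCosetPoset H) ∧
      orderComplexDim (CosetPoset H) = 1 ∧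
      reducedBetti (CosetPoset H) 1 ≠ 0) := by
  refine ⟨fun n hn hB => ?_, fun hB => ?_⟩
  · obtain ⟨M, N, hHM, hHN, hM, hN, hsup⟩ := hB.exists_sup_eq_top hn
    exact isConnectedPoset_cosetPoset hHM hHN hM hN hsup
  · obtain ⟨M, N, h⟩ := hB.exists_isDiamondInterval
    have hconn := isConnectedPoset_cosetPoset h.lt_left.le h.lt_right.le h.left_lt_top
      h.right_lt_top h.sup_eq_top
    have hne : Nonempty (CosetPoset H) := hconn.nonempty
    have hempty := h.isEmpty_chain_three
    refine ⟨?_, ?_, orderComplexDim_eq_one ?_ hempty, reducedBetti_one_ne_zero h.card_cosetPoset_le⟩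
    · have := h.index_add_index_le
      rw [h.dualEulerTotient_eq]
      omega
    · exact isCohenMacaulayPoset_of_rank_three (BoundedCosetPoset.rank_strictMono h)
        BoundedCosetPoset.rank_bot BoundedCosetPoset.rank_top
        (BoundedCosetPoset.exists_le_rank_eq_one h.lt_top)
        (BoundedCosetPoset.exists_ge_rank_eq_two h)
        (hconn.of_orderIso (BoundedCosetPoset.properPartIso H))
    · exact (Nat.card_pos_iff.1 (Nat.card_pos.trans_le h.card_cosetPoset_le)).1
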